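/- Let $N\ge 2$, and write $\hat v=v/\|v\|$ and $\angle(v,w)$ for the angle between $v$ and $w$. **Directions and rotations.** For nonzero $v_i,v_o\in\mathbb R^N$ let $b_i=\hat v_i$, let $b_o$ be the normalized part of $\hat v_o$ perpendicular to $b_i$ (an arbitrary unit vector perpendicular to $b_i$ if $v_i,v_o$ are anti-collinear), and let $\beta=\angle(v_i,v_o)$. The vector rotation defined by $(v_i,v_o)$ is the rotation by $\beta$ in the plane of $b_i,b_o$, from $b_i$ towards $b_o$, which fixes the orthogonal complement of the plane. The direction-space map is $k(v_i,v_o)=\beta\,b_o\in v_i^{\perp}\cong\mathbb R^{N-1}$, with inverse $\bar k(b,t)=\cos(\|t\|)\,\hat b+\sin(\|t\|)\,\hat t$. The rotational sum is $v_0\,\hat+\sum_c w_cv_c=\bar k\big(v_0,\sum_c w_c\,k(v_0,v_c)\big)$. **Weighted sum of a rotation tree.** Let a finite rooted tree have a direction $v_n$ and a weight at each node $n$, and let $W_n$ be the sum of the weights of $n$ and all its offspring. Start with $v^*=\hat v_{\mathrm{root}}$. For $l=1,2,\dots$ put $v'=v^*\,\hat+\sum_{c\text{ of level }l}W_c v_c$;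 then apply to each node $c$ of level $l$ and all its offspring the inverse of the rotation defined by $(v^*,v_c)$, followed by the rotation defined by $(v^*,v')$; and replace $v^*$ by $v'$. The final $v^*$ is the weighted sum of the tree. **Obstacles.** A star-shaped obstacle is given by a reference point $\xi^r$ and a continuous $\Gamma:\mathbb R^N\to[0,\infty)$ with $\Gamma(\xi^r)<1$ that is strictly increasing on each ray from $\xi^r$, such that each such ray meets the boundary $\{\Gamma=1\}$ (at $\xi^b$), and on $\{\Gamma\ge1\}$ the function is $C^1$ with $\Gamma(\xi)=\|\xi-\xi^b(\xi)\|/d_0+1$ for a constant $d_0>0$. Its interior is $\{\Gamma<1\}$, its free space $\{\Gamma>1\}$. Put $n=\nabla\Gamma$ and $r=(\xi^r-\xi)/\|\xi^r-\xi\|$. A tree of obstacles is a finite rooted tree of star-shaped obstacles in which the interiors of each obstacle and its parent meet. Let $p(o)$ be the parent of $o$ and $\xi^r_o,\Gamma_o,n_o,r_o$ the data of $o$. Let $f:\mathbb R^N\to\mathbb R^N$ be $C^1$, let $R^e\in[\pi/2,\pi]$ and $s>0$. The field at $\xi$ is built as follows. 1. *Surface points.* For each obstacle $o$, $s_o$ is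 the point of the boundary of $o$ on the ray from $\xi^r_o$ through $\xi$. Along the path from $o$ to the root, $s_{p(c)}=s_c+b(\xi^r_c-s_c)$ with $b>0$ and $\Gamma_{p(c)}(s_{p(c)})=1$, chosen with $\Gamma_c(s_{p(c)})<1$ if possible. 2. *Propagated velocity.* At the root the direction is that of $f(\xi^r_{\mathrm{root}})$. At each step from $p(c)$ to $c$ on the path to $o$, the direction $f_c$ is obtained from $f_{p(c)}$ by the rotation defined by $v_i=s_c-\xi^r_c$ and $v_o=s_{p(c)}-\xi^r_{p(c)}$. The result at $o$ is $f_o$. 3. *Pseudo-tangent.* If $\langle-\hat n_o,f_o\rangle>\cos R^e$, then $e_o=\bar k\big({-n_o},\,k(-n_o,r_o)+b(k(-n_o,f_o)-k(-n_o,r_o))\big)$ with $b>0$ such that the second argument has norm $R^e$. Otherwise, $e_o$ is given by the same formula with $n_o,-r_o,\pi-R^e$ in place of $-n_o,r_o,R^e$. If no such $b$ exists, $e_o=f_o$. 4. *Weights.* For $o$ not the root let $g=\Gamma_{p(o)}(s_o)$ and $b=\cos\angle(\xi-\xi^r_o,\;\xi^r_{p(o)}-\xi^r_o)$. The hiding weight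 is $w^h_o=1$ if $g>1$; otherwise $w^h_o=g^{1/(1-b)}$ if $b<1$, and $w^h_o=0$ if $b=1$. For the root $w^h=1$. The obstacle weight is $w_o=\prod_{i\ne o}(\Gamma_i-1)\big/\sum_j\prod_{i\ne j}(\Gamma_i-1)$. With $\Delta k_o=\|k(-n_o,r_o)-k(-n_o,f_o)\|$ and $R^r_o=\min(R^e-\|k(-n_o,r_o)\|,\pi/2)$, the rotation weight is $\lambda_o=\Gamma_o^{-q_o}$, $q_o=\max(1,R^r_o/\Delta k_o)^s$, and $\lambda_o=0$ if $\Delta k_o=0$. Put $\omega_o=w^h_o\lambda_ow_o$. 5. *Rotation tree.* The root is $f(\xi)$ with weight $1-\sum_o\omega_o$. For each $o$ it has a branch consisting of the directions propagated from the root obstacle to $o$ (weight $0$), followed by $e_o$ (weight $\omega_o$). Let $v^*(\xi)$ be the weighted sum of this tree. 6. *Field.* $\dot\xi=h\,\|f(\xi)\|\,v^*(\xi)$, where $h=\sum_ow_oh_o$ and $h_o=\min\big(1,(\Delta k_o/R^r_o)^2+(1-1/\Gamma_o)^2\big)$. **Statement.** Assume that for each obstacle $o$ other than the root, $\xi^r_o$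 lies in the interiors of $o$ and of $p(o)$, and $\xi^r_{p(o)}$ lies in the interior of $p(o)$ but not in that of $o$; and that whenever $c$ and $p(c)$ are not the root, $\xi^r_{p(c)}-\xi^r_c$ and $\xi^r_{p(p(c))}-\xi^r_{p(c)}$ are not anti-collinear. Assume that $f$ is straight on an open neighbourhood $U$ of all obstacles (along each trajectory $\xi_t$ of $\dot\xi=f(\xi)$ that stays in $U$, $\langle f(\xi_0),f(\xi_t)\rangle=\|f(\xi_0)\|\,\|f(\xi_t)\|$), and that $f(\xi^r_{\mathrm{root}})\ne0$. Then: * (collision avoidance) $\langle n_o(\xi),\dot\xi\rangle\ge0$ for every obstacle $o$ and every $\xi$ with $\Gamma_o(\xi)=1$ and $\Gamma_i(\xi)>1$ for all $i\ne o$; * (no local minima in free space) if $\Gamma_o(\xi)>1$ for all $o$, then $\dot\xi=0$ if and only if $f(\xi)=0$, i.e. the field has no stationary points in free space besides those of $f$. -/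

import Mathlib

open Set
open scoped RealInnerProductSpace

noncomputable section

namespace Roam

/-- The state space of dimension `N`, with the Euclidean norm. -/
abbrev State (N : ℕ) : Type := EuclideanSpace ℝ (Fin N)

/-! ### Rotations of directions -/

/-- The unit vector in the direction of `v` (zero if `v = 0`). -/
def unit {N : ℕ} (v : State N) : State N := ‖v‖⁻¹ • v

open Classical in
/-- Second base vector `b_o` of the rotation that takes the direction of `vi` to the direction of
`vo`: the normalized part of `vo` perpendicular to `vi`.  For anti-collinear vectors the plane of
rotation is not determined by the two vectors, and an arbitrary one that contains `vi` is used. -/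
def perpBase {N : ℕ} (vi vo : State N) : State N :=
  if unit vo = -unit vi then
    if h : ∃ u : State N, ‖u‖ = 1 ∧ ⟪vi, u⟫ = 0 then h.choose else 0
  else unit (unit vo - ⟪unit vi, unit vo⟫ • unit vi)

/-- Rotation by the angle `β` in the plane with orthonormal base `bi`, `bo` (from `bi` towards
`bo`); the part of `v` orthogonal to this plane is kept. -/
def planeRot {N : ℕ} (bi bo : State N) (β : ℝ) (v : State N) : State N :=
  (Real.cos β * ⟪bi, v⟫ - Real.sin β * ⟪bo, v⟫) • bi
    + (Real.sin β * ⟪bi, v⟫ + Real.cos β * ⟪bo, v⟫) • bo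
    + (v - ⟪bi, v⟫ • bi - ⟪bo, v⟫ • bo)

/-- The vector rotation defined by the input vector `vi` and the output vector `vo`, applied to
`v`. -/
def rot {N : ℕ} (vi vo v : State N) : State N :=
  planeRot (unit vi) (perpBase vi vo) (InnerProductGeometry.angle vi vo) v

/-- The inverse of the vector rotation defined by `vi` and `vo`, applied to `v`. -/
def rotInv {N : ℕ} (vi vo v : State N) : State N :=
  planeRot (unit vi) (perpBase vi vo) (-InnerProductGeometry.angle vi vo) v

/-- The direction-space map `k(b, x)`.  The direction space `ℝ^(N-1)` is realized as the orthogonal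
complement of `b`, so that no orthonormal basis of it has to be chosen: the result points from `b`
to `x` and its length is the angle between `b` and `x`. -/
def dirMap {N : ℕ} (b x : State N) : State N :=
  InnerProductGeometry.angle b x • perpBase b x

/-- The inverse direction-space map, which takes a vector `t` orthogonal to `b` to a unit vector. -/
def dirInv {N : ℕ} (b t : State N) : State N :=
  Real.cos ‖t‖ • unit b + Real.sin ‖t‖ • unit t

/-! ### Direction trees and their weighted sum -/

/-- A direction tree: a rooted tree with a direction and a weight at each node. -/
structure DirectionTree (N : ℕ) (ν : Type) where
  root : ν
  parent : ν → ν
  level : ν → ℕ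
  value : ν → State N
  weight : ν → ℝ
  level_root : level root = 0
  level_parent : ∀ n, n ≠ root → level n = level (parent n) + 1

namespace DirectionTree

variable {N : ℕ} {ν : Type}

/-- The ancestor of `n` (or `n` itself) at level `l ≤ level n`. -/
def ancestorAt (T : DirectionTree N ν) (n : ν) (l : ℕ) : ν :=
  T.parent^[T.level n - l] n

open Classical in
/-- Cumulative weight of a node: the sum of the weights of the node and of all its offspring. -/
def cumWeight [Fintype ν] (T : DirectionTree N ν) (n : ν) : ℝ :=
  ∑ m with T.level n ≤ T.level m ∧ T.ancestorAt m (T.level n) = n, T.weight m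

open Classical in
/-- State of the reduction of the tree after level `l`: the averaged direction `v*`, and the
current directions of the nodes.  A step takes the rotational sum over the nodes of the next level,
with their cumulative weights, from the averaged direction `v*` to a new averaged direction `v'`;
then each node of that level and all its offspring are rotated back from the node to `v*`, and
forth from `v*` to `v'`. -/
def reduce [Fintype ν] (T : DirectionTree N ν) : ℕ → State N × (ν → State N)
  | 0 => (unit (T.value T.root), T.value)
  | l + 1 =>
    let v := (T.reduce l).1
    let val := (T.reduce l).2
    let v' := dirInv v (∑ c with T.level c = l + 1, T.cumWeight c • dirMap v (val c))
    (v', fun n =>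
      if l + 1 ≤ T.level n then rot v v' (rotInv v (val (T.ancestorAt n (l + 1))) (val n))
      else val n)

/-- The weighted sum of the direction tree. -/
def eval [Fintype ν] (T : DirectionTree N ν) : State N :=
  (T.reduce (Finset.univ.sup T.level)).1

end DirectionTree

/-! ### Star-shaped obstacles -/

/-- A star-shaped obstacle, given by its distance function `Γ` and its reference point. -/
structure StarObstacle (N : ℕ) where
  Γ : State N → ℝ
  ref : State N
  /-- scaling factor of the distance -/
  d₀ : ℝ
  d₀_pos : 0 < d₀
  nonneg : ∀ x, 0 ≤ Γ x
  continuous : Continuous Γ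
  ref_inside : Γ ref < 1
  radial : ∀ x, x ≠ ref → StrictMonoOn (fun t : ℝ => Γ (ref + t • (x - ref))) (Ici 0)
  /-- each ray from the reference point meets the boundary -/
  exists_boundary : ∀ x, x ≠ ref → ∃ b : ℝ, 0 < b ∧ Γ (ref + b • unit (x - ref)) = 1
  /-- outside, `Γ` is the scaled radial distance to the boundary -/
  dist_eq : ∀ x, 1 ≤ Γ x → ∀ b : ℝ, 0 < b → Γ (ref + b • unit (x - ref)) = 1 →
    Γ x = ‖x - (ref + b • unit (x - ref))‖ / d₀ + 1
  smooth : ∀ x, 1 ≤ Γ x → ContDiffAt ℝ 1 Γ x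

namespace StarObstacle

variable {N : ℕ}

def free (O : StarObstacle N) : Set (State N) := {x | 1 < O.Γ x}

def boundary (O : StarObstacle N) : Set (State N) := {x | O.Γ x = 1}

def interior (O : StarObstacle N) : Set (State N) := {x | O.Γ x < 1}

/-- The normal direction, i.e. the derivative of the distance function. -/
def normal (O : StarObstacle N) (x : State N) : State N := gradient O.Γ x

/-- The reference direction, from the position towards the reference point. -/
def refDir (O : StarObstacle N) (x : State N) : State N := unit (O.ref - x)

open Classical in
/-- The point of the boundary on the ray from the reference point through `x`. -/
def boundaryPoint (O : StarObstacle N) (x : State N) : State N :=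
  if h : ∃ b : ℝ, 0 < b ∧ O.Γ (O.ref + b • unit (x - O.ref)) = 1 then
    O.ref + h.choose • unit (x - O.ref)
  else x

/-- Distance in the direction space `k(-n, ·)` between the reference direction and the direction
`c`. -/
def deltaK (O : StarObstacle N) (x c : State N) : ℝ :=
  ‖dirMap (-O.normal x) (O.refDir x) - dirMap (-O.normal x) c‖

/-- The reference radius `R^r` for the tangent radius `Re`. -/
def refRadius (O : StarObstacle N) (Re : ℝ) (x : State N) : ℝ :=
  min (Re - ‖dirMap (-O.normal x) (O.refDir x)‖) (Real.pi / 2)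

/-- Rotation weight `λ = (1 / Γ) ^ q` with `q = max(1, R^r / Δk) ^ s`; where `Δk = 0` it takes its
limit value `0` (as `q` tends to infinity). -/
def rotWeight (O : StarObstacle N) (Re s : ℝ) (x c : State N) : ℝ :=
  if O.deltaK x c = 0 then 0
  else (1 / O.Γ x) ^ ((max 1 (O.refRadius Re x / O.deltaK x c)) ^ s)

/-- Magnitude scaling. -/
def speed (O : StarObstacle N) (Re : ℝ) (x c : State N) : ℝ :=
  min 1 ((O.deltaK x c / O.refRadius Re x) ^ 2 + (1 - 1 / O.Γ x) ^ 2)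

open Classical in
/-- The direction with base `b` that lies in the direction space `k(b, ·)` on the half-line from
the direction `p` through the direction `q`, at distance `R` from the origin.  If there is no such
direction (e.g. if `p` and `q` agree), the direction `q` is kept. -/
def intersectCircle (b p q : State N) (R : ℝ) : State N :=
  if h : ∃ a : ℝ, 0 < a ∧ ‖dirMap b p + a • (dirMap b q - dirMap b p)‖ = R then
    dirInv b (dirMap b p + h.choose • (dirMap b q - dirMap b p))
  else unit q

/-- The pseudo-tangent of a component of a tree of obstacles for the propagated velocity `v`. -/
def pseudoTangent (O : StarObstacle N) (Re : ℝ) (x v : State N) : State N :=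
  if Real.cos Re < ⟪-unit (O.normal x), unit v⟫ then
    intersectCircle (-O.normal x) (O.refDir x) v Re
  else
    intersectCircle (O.normal x) (-O.refDir x) v (Real.pi - Re)

end StarObstacle

/-! ### Straight dynamics -/

/-- The dynamics `f` are straight within `U`: along each trajectory that remains in `U`, the
velocity stays collinear with the initial velocity. -/
def StraightOn {N : ℕ} (f : State N → State N) (U : Set (State N)) : Prop :=
  ∀ (T : ℝ) (x : ℝ → State N),
    (∀ t ∈ Icc 0 T, x t ∈ U ∧ HasDerivWithinAt x (f (x t)) (Icc 0 T) t) →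
    ∀ t ∈ Icc 0 T, ⟪f (x 0), f (x t)⟫ = ‖f (x 0)‖ * ‖f (x t)‖

/-! ### Trees of obstacles -/

/-- A tree of star-shaped obstacles; each obstacle but the root intersects its parent. -/
structure ObstacleTree (N : ℕ) (ι : Type) where
  obs : ι → StarObstacle N
  root : ι
  /-- the parent of an obstacle; the value at the root has no meaning -/
  parent : ι → ι
  level : ι → ℕ
  level_root : level root = 0
  level_parent : ∀ o, o ≠ root → level o = level (parent o) + 1
  inter_parent : ∀ o, o ≠ root → ((obs o).interior ∩ (obs (parent o)).interior).Nonempty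

namespace ObstacleTree

variable {N : ℕ} {ι : Type}

/-- The free space of the tree. -/
def free (T : ObstacleTree N ι) : Set (State N) := {x | ∀ o, x ∈ (T.obs o).free}

/-- The part of the boundary of the tree that belongs to the obstacle `o` alone. -/
def boundaryOf (T : ObstacleTree N ι) (o : ι) : Set (State N) :=
  {x | x ∈ (T.obs o).boundary ∧ ∀ i, i ≠ o → x ∈ (T.obs i).free}

open Classical in
/-- From the point `s` on the surface of `c`, the surface point of the parent `p` on the half-line
from `s` through the reference point of `c`; a point inside of `c` is taken if there is one. -/
def propagate (c p : StarObstacle N) (s : State N) : State N :=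
  if h : ∃ b : ℝ, 0 < b ∧ p.Γ (b • (c.ref - s) + s) = 1 ∧ c.Γ (b • (c.ref - s) + s) < 1 then
    h.choose • (c.ref - s) + s
  else if h : ∃ b : ℝ, 0 < b ∧ p.Γ (b • (c.ref - s) + s) = 1 then
    h.choose • (c.ref - s) + s
  else s

/-- The surface point at the `k`-th ancestor of `o`, propagated from the projection of the
position `x` on the surface of `o`. -/
def surfacePoint (T : ObstacleTree N ι) (x : State N) (o : ι) : ℕ → State N
  | 0 => (T.obs o).boundaryPoint x
  | k + 1 => propagate (T.obs (T.parent^[k] o)) (T.obs (T.parent^[k + 1] o))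
      (T.surfacePoint x o k)

/-- The vector from the reference point of the `k`-th ancestor of `o` to its surface point. -/
def surfaceDir (T : ObstacleTree N ι) (x : State N) (o : ι) (k : ℕ) : State N :=
  T.surfacePoint x o k - (T.obs (T.parent^[k] o)).ref

/-- The direction of the velocity propagated to the level `j` on the way from the root to `o`.  It
is the velocity at the reference point of the root at first, and is then rotated at each step from
the parent to the component `c`, by the vector rotation with input `s_c - ξ^r_c` and output
`s_{p(c)} - ξ^r_{p(c)}`. -/
def velocityAt (T : ObstacleTree N ι) (f : State N → State N) (x : State N) (o : ι) :
    ℕ → State N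
  | 0 => unit (f (T.obs T.root).ref)
  | j + 1 => rot (T.surfaceDir x o (T.level o - (j + 1))) (T.surfaceDir x o (T.level o - j))
      (T.velocityAt f x o j)

/-- The direction of the velocity propagated to the obstacle `o`. -/
def velocity (T : ObstacleTree N ι) (f : State N → State N) (x : State N) (o : ι) : State N :=
  T.velocityAt f x o (T.level o)

open Classical in
/-- The hiding weight. -/
def hidingWeight (T : ObstacleTree N ι) (x : State N) (o : ι) : ℝ :=
  if o = T.root then 1
  else
    let g := (T.obs (T.parent o)).Γ ((T.obs o).boundaryPoint x)
    let b := ⟪unit (x - (T.obs o).ref), unit ((T.obs (T.parent o)).ref - (T.obs o).ref)⟫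
    if 1 < g then 1 else if b < 1 then g ^ (1 / (1 - b)) else 0

open Classical in
/-- The obstacle weight: in free space this is `1 / (Γ_o - 1)`, normalized to a sum of one; it is
written without division by `Γ_o - 1` so that it has the right value, one, on the surface of
`o`. -/
def obstacleWeight [Fintype ι] (T : ObstacleTree N ι) (x : State N) (o : ι) : ℝ :=
  (∏ i ∈ Finset.univ.erase o, ((T.obs i).Γ x - 1)) /
    ∑ j, ∏ i ∈ Finset.univ.erase j, ((T.obs i).Γ x - 1)

/-- The weight of the pseudo-tangent of the obstacle `o` in the rotation tree. -/
def nodeWeight [Fintype ι] (T : ObstacleTree N ι) (Re s : ℝ) (f : State N → State N)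
    (x : State N) (o : ι) : ℝ :=
  T.hidingWeight x o * ((T.obs o).rotWeight Re s x (T.velocity f x o) * T.obstacleWeight x o)

/-- The rotation tree at the position `x`.  Its root is the initial velocity `f x`; each obstacle
`o` contributes the branch of the velocities propagated from the root obstacle to `o`, followed by
the pseudo-tangent of `o`.  The weights sum to one; they are carried by the root and by the
pseudo-tangents. -/
def rotationTree [Fintype ι] (T : ObstacleTree N ι) (Re s : ℝ) (f : State N → State N)
    (x : State N) : DirectionTree N (Option (Σ o : ι, Fin (T.level o + 2))) where
  root := none
  parent n := match n with
    | none => none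
    | some ⟨o, j⟩ => if (j : ℕ) = 0 then none else some ⟨o, ⟨j - 1, by omega⟩⟩
  level n := match n with
    | none => 0
    | some ⟨_, j⟩ => j + 1
  value n := match n with
    | none => f x
    | some ⟨o, j⟩ =>
      if (j : ℕ) ≤ T.level o then T.velocityAt f x o j
      else (T.obs o).pseudoTangent Re x (T.velocity f x o)
  weight n := match n with
    | none => 1 - ∑ o, T.nodeWeight Re s f x o
    | some ⟨o, j⟩ => if (j : ℕ) ≤ T.level o then 0 else T.nodeWeight Re s f x o
  level_root := rfl
  level_parent n hn := by
    rcases n with _ | ⟨o, j⟩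
    · exact absurd rfl hn
    · by_cases h : (j : ℕ) = 0
      · simp [h]
      · simp only [h, if_false]
        omega

/-- The vector field that avoids the tree of obstacles: its direction is the weighted sum of the
rotation tree, its magnitude that of `f`, scaled by the weighted magnitude scalings of the
obstacles. -/
def field [Fintype ι] (T : ObstacleTree N ι) (Re s : ℝ) (f : State N → State N)
    (x : State N) : State N :=
  ((∑ o, T.obstacleWeight x o * (T.obs o).speed Re x (T.velocity f x o)) * ‖f x‖) •
    (T.rotationTree Re s f x).eval

end ObstacleTree

end Roam

end

/-! Both claims rest on the weighted sum of a rotation tree. Every averaging step applies the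
inverse direction map to a vector orthogonal to the current average, so the sum is always a unit
vector (`norm_eval`). In free space each speed factor is positive, because `1 - 1/Γ > 0`, and so are
the obstacle weights; hence the field vanishes only where `f` does.

On the boundary of `o` alone, the obstacle weights concentrate on `o`, its hiding weight is one, and
its rotation weight is a power of one. If `Δk_o ≠ 0`, the pseudo-tangent of `o` therefore carries
the whole weight of the tree, and the weighted sum equals it (`eval_of_single`), since the rotations
along its branch cancel. The pseudo-tangent makes an angle of at least `Re ≥ π/2` with the inward
normal (`inner_normal_pseudoTangent`). If `Δk_o = 0`, the speed vanishes and the direction is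
irrelevant.

The rotations and angles need nonzero vectors. Propagated velocities are nonzero because a half-line
through the child's reference point, which lies inside the parent, must leave the parent, so
propagated surface points never meet reference points. -/

open scoped RealInnerProductSpace
open InnerProductGeometry

namespace Roam

/-! ### Unit vectors, plane rotations and the direction-space map. -/

section Vectors

variable {N : ℕ}

theorem norm_unit {v : State N} (hv : v ≠ 0) : ‖unit v‖ = 1 := by
  rw [unit, norm_smul, norm_inv, norm_norm, inv_mul_cancel₀ (norm_ne_zero_iff.2 hv)]

theorem norm_unit_le (v : State N) : ‖unit v‖ ≤ 1 := by
  by_cases hv : v = 0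
  · simp [hv, unit]
  · exact (norm_unit hv).le

@[simp] theorem unit_zero : unit (0 : State N) = 0 := by simp [unit]

theorem unit_of_norm_eq_one {v : State N} (hv : ‖v‖ = 1) : unit v = v := by simp [unit, hv]

theorem unit_unit (v : State N) : unit (unit v) = unit v := by
  by_cases hv : v = 0
  · simp [hv]
  · exact unit_of_norm_eq_one (norm_unit hv)

theorem unit_neg (v : State N) : unit (-v) = -unit v := by simp [unit]

theorem norm_smul_unit (v : State N) : ‖v‖ • unit v = v := by
  by_cases hv : v = 0
  · simp [hv]
  · rw [unit, smul_smul, mul_inv_cancel₀ (norm_ne_zero_iff.2 hv), one_smul]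

theorem unit_ne_zero {v : State N} (hv : v ≠ 0) : unit v ≠ 0 := by
  rw [← norm_ne_zero_iff, norm_unit hv]
  exact one_ne_zero

theorem inner_unit_unit (v w : State N) (hv : v ≠ 0) (hw : w ≠ 0) :
    ⟪unit v, unit w⟫ = Real.cos (angle v w) := by
  rw [cos_angle, unit, unit, real_inner_smul_left, real_inner_smul_right]
  field_simp

theorem angle_unit_right (v w : State N) : angle v (unit w) = angle v w := by
  by_cases hw : w = 0
  · simp [hw]
  · exact angle_smul_right_of_pos v w (inv_pos.2 (norm_pos_iff.2 hw))

theorem inner_unit_perpBase (v w : State N) : ⟪unit v, perpBase v w⟫ = 0 := by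
  unfold perpBase
  split_ifs with h₁ h₂
  · rw [unit, real_inner_smul_left, h₂.choose_spec.2, mul_zero]
  · exact inner_zero_right _
  · by_cases hv : v = 0
    · simp [hv]
    · rw [unit.eq_1 (_ - _), real_inner_smul_right, inner_sub_right, real_inner_smul_right,
        real_inner_self_eq_norm_sq, norm_unit hv]
      ring

theorem norm_perpBase_le (v w : State N) : ‖perpBase v w‖ ≤ 1 := by
  unfold perpBase
  split_ifs with h₁ h₂
  · exact h₂.choose_spec.1.le
  · simp
  · exact norm_unit_le _

theorem perpBase_unit_right (v w : State N) : perpBase v (unit w) = perpBase v w := by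
  simp only [perpBase, unit_unit]

theorem exists_unit_orthogonal (hN : 2 ≤ N) (v : State N) :
    ∃ u : State N, ‖u‖ = 1 ∧ ⟪v, u⟫ = 0 := by
  have h : Module.finrank ℝ (Submodule.span ℝ {v}) < Module.finrank ℝ (State N) := by
    have : Module.finrank ℝ (Submodule.span ℝ {v}) ≤ 1 :=
      (finrank_span_le_card (R := ℝ) ({v} : Set (State N))).trans (by simp)
    rw [finrank_euclideanSpace_fin]
    omega
  obtain ⟨w, hw, hw0⟩ := Submodule.exists_mem_ne_zero_of_ne_bot
    (p := (Submodule.span ℝ {v})ᗮ) (by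
      intro hbot
      rw [Submodule.orthogonal_eq_bot_iff] at hbot
      rw [hbot, finrank_top] at h
      exact h.false)
  refine ⟨unit w, norm_unit hw0, ?_⟩
  rw [unit, real_inner_smul_right, (Submodule.mem_orthogonal_singleton_iff_inner_right).1 hw,
    mul_zero]

/-- The decomposition of a direction along the base vectors of the rotation towards it. -/
theorem unit_eq_cos_add_sin {v w : State N} (hv : v ≠ 0) (hw : w ≠ 0) :
    unit w = Real.cos (angle v w) • unit v + Real.sin (angle v w) • perpBase v w := by
  by_cases h : unit w = -unit v
  -- In the anti-collinear case the arbitrary choice of `perpBase` is harmless: its coefficient, the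
  -- sine, is zero.
  · have hc : Real.cos (angle v w) = -1 := by
      rw [← inner_unit_unit v w hv hw, h, inner_neg_right, real_inner_self_eq_norm_sq,
        norm_unit hv]
      norm_num
    have hs : Real.sin (angle v w) = 0 := by
      have := Real.sin_sq_add_cos_sq (angle v w)
      rw [hc] at this
      nlinarith
    rw [hc, hs, h]
    simp
  · have hd : ‖unit w - ⟪unit v, unit w⟫ • unit v‖ = Real.sin (angle v w) := by
      rw [← sq_eq_sq₀ (norm_nonneg _) (sin_angle_nonneg v w), norm_sub_sq_real, norm_smul,
        real_inner_smul_right, norm_unit hv, norm_unit hw, real_inner_comm (unit v) (unit w),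
        inner_unit_unit v w hv hw, Real.sin_sq, Real.norm_eq_abs, mul_one, sq_abs]
      ring
    rw [perpBase, if_neg h, ← hd, norm_smul_unit, inner_unit_unit v w hv hw]
    abel

theorem norm_perpBase (hN : 2 ≤ N) {v w : State N} (hv : v ≠ 0) (hw : w ≠ 0)
    (hvw : unit w ≠ unit v) : ‖perpBase v w‖ = 1 := by
  unfold perpBase
  split_ifs with h₁ h₂
  · exact h₂.choose_spec.1
  · exact absurd (exists_unit_orthogonal hN v) h₂
  · refine norm_unit fun h => ?_
    have h' := sub_eq_zero.1 h
    have hn := congrArg norm h'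
    rw [norm_smul, norm_unit hv, norm_unit hw, mul_one, Real.norm_eq_abs] at hn
    rcases eq_or_eq_neg_of_abs_eq hn.symm with hc | hc
    · exact hvw (by rw [h', hc, one_smul])
    · exact h₁ (by rw [h', hc, neg_one_smul])

theorem inner_unit_dirMap (v w : State N) : ⟪unit v, dirMap v w⟫ = 0 := by
  rw [dirMap, real_inner_smul_right, inner_unit_perpBase, mul_zero]

theorem norm_dirMap_le (v w : State N) : ‖dirMap v w‖ ≤ angle v w := by
  rw [dirMap, norm_smul, Real.norm_eq_abs, abs_of_nonneg (angle_nonneg v w)]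
  exact mul_le_of_le_one_right (angle_nonneg v w) (norm_perpBase_le v w)

theorem inner_unit_unit_of_inner_eq_zero {b t : State N} (h : ⟪unit b, t⟫ = 0) :
    ⟪unit b, unit t⟫ = 0 := by
  rw [unit.eq_1 t, real_inner_smul_right, h, mul_zero]

theorem inner_unit_dirInv {b t : State N} (hb : b ≠ 0) (h : ⟪unit b, t⟫ = 0) :
    ⟪unit b, dirInv b t⟫ = Real.cos ‖t‖ := by
  rw [dirInv, inner_add_right, real_inner_smul_right, real_inner_smul_right,
    inner_unit_unit_of_inner_eq_zero h, real_inner_self_eq_norm_sq, norm_unit hb]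
  ring

theorem norm_dirInv {b t : State N} (hb : b ≠ 0) (h : ⟪unit b, t⟫ = 0) :
    ‖dirInv b t‖ = 1 := by
  by_cases ht : t = 0
  · simp [dirInv, ht, norm_unit hb]
  · rw [← sq_eq_sq₀ (norm_nonneg _) zero_le_one, dirInv, norm_add_sq_real, norm_smul, norm_smul,
      real_inner_smul_left, real_inner_smul_right, inner_unit_unit_of_inner_eq_zero h,
      norm_unit hb, norm_unit ht, Real.norm_eq_abs, Real.norm_eq_abs, mul_one, mul_one, sq_abs,
      sq_abs]
    linarith [Real.sin_sq_add_cos_sq ‖t‖]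

theorem dirInv_zero (b : State N) : dirInv b 0 = unit b := by simp [dirInv]

theorem dirInv_dirMap (hN : 2 ≤ N) {v w : State N} (hv : v ≠ 0) (hw : w ≠ 0) :
    dirInv v (dirMap v w) = unit w := by
  by_cases hvw : unit w = unit v
  · have h : angle v w = 0 := by
      have hc := inner_unit_unit v w hv hw
      rw [hvw, real_inner_self_eq_norm_sq, norm_unit hv] at hc
      exact Real.injOn_cos ⟨angle_nonneg v w, angle_le_pi v w⟩ ⟨le_rfl, Real.pi_pos.le⟩
        (by rw [← hc, Real.cos_zero]; norm_num)
    rw [dirMap, h, zero_smul, dirInv_zero, hvw]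
  · have h1 := norm_perpBase hN hv hw hvw
    have hn : ‖dirMap v w‖ = angle v w := by
      rw [dirMap, norm_smul, h1, mul_one, Real.norm_eq_abs, abs_of_nonneg (angle_nonneg v w)]
    rw [dirInv, hn, unit_eq_cos_add_sin hv hw]
    congr 1
    rcases (angle_nonneg v w).eq_or_lt with h0 | h0
    · simp [← h0]
    · congr 1
      rw [unit, hn, dirMap, smul_smul, inv_mul_cancel₀ h0.ne', one_smul]

/-- The case `bo = 0` is admitted because `perpBase` vanishes for vectors of equal direction; there
the angle is zero and the rotation is the identity. -/
theorem planeRot_comp_neg {bi bo : State N} (hi : ‖bi‖ = 1) (ho : ‖bo‖ = 1 ∨ bo = 0)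
    (hio : ⟪bi, bo⟫ = 0) {β : ℝ} (hβ : bo = 0 → β = 0) (v : State N) :
    planeRot bi bo β (planeRot bi bo (-β) v) = v := by
  have hii : ⟪bi, bi⟫ = 1 := by rw [real_inner_self_eq_norm_sq, hi, one_pow]
  have hoi : ⟪bo, bi⟫ = 0 := by rw [real_inner_comm, hio]
  rcases ho with ho | ho
  · have hoo : ⟪bo, bo⟫ = 1 := by rw [real_inner_self_eq_norm_sq, ho, one_pow]
    simp only [planeRot, inner_add_right, inner_sub_right, real_inner_smul_right, hii, hoo, hio,
      hoi, Real.cos_neg, Real.sin_neg]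
    have hcs := Real.sin_sq_add_cos_sq β
    match_scalars <;>
      first | ring1 | linear_combination ⟪bi, v⟫ * hcs | linear_combination ⟪bo, v⟫ * hcs
  · simp [planeRot, ho, hβ ho]

theorem norm_perpBase_or (hN : 2 ≤ N) {v w : State N} (hv : v ≠ 0) (hw : w ≠ 0) :
    ‖perpBase v w‖ = 1 ∨ (perpBase v w = 0 ∧ angle v w = 0) := by
  by_cases hvw : unit w = unit v
  · right
    have hc := inner_unit_unit v w hv hw
    rw [hvw, real_inner_self_eq_norm_sq, norm_unit hv] at hc
    have hne : unit w ≠ -unit v := by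
      rw [hvw]
      intro h
      have h2 : (2 : ℝ) • unit v = 0 := by
        rw [two_smul]
        exact eq_neg_iff_add_eq_zero.1 h
      exact unit_ne_zero hv ((smul_eq_zero.1 h2).resolve_left two_ne_zero)
    constructor
    · rw [perpBase, if_neg hne, hvw, real_inner_self_eq_norm_sq, norm_unit hv]
      simp
    · exact Real.injOn_cos ⟨angle_nonneg v w, angle_le_pi v w⟩ ⟨le_rfl, Real.pi_pos.le⟩
        (by rw [← hc, Real.cos_zero]; norm_num)
  · exact .inl (norm_perpBase hN hv hw hvw)

theorem rot_rotInv (hN : 2 ≤ N) {v w : State N} (hv : v ≠ 0) (hw : w ≠ 0) (u : State N) :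
    rot v w (rotInv v w u) = u := by
  have h := norm_perpBase_or hN hv hw
  refine planeRot_comp_neg (norm_unit hv) (h.imp_right And.left) (inner_unit_perpBase v w) ?_ u
  intro h0
  rcases h with h | h
  · simp [h0] at h
  · exact h.2

theorem rotInv_rot (hN : 2 ≤ N) {v w : State N} (hv : v ≠ 0) (hw : w ≠ 0) (u : State N) :
    rotInv v w (rot v w u) = u := by
  have h := norm_perpBase_or hN hv hw
  have := planeRot_comp_neg (norm_unit hv) (h.imp_right And.left) (inner_unit_perpBase v w)
    (β := -angle v w) (fun h0 => by
      rcases h with h | h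
      · simp [h0] at h
      · simp [h.2]) u
  rwa [neg_neg] at this

theorem rot_ne_zero (hN : 2 ≤ N) {v w u : State N} (hv : v ≠ 0) (hw : w ≠ 0) (hu : u ≠ 0) :
    rot v w u ≠ 0 := by
  intro h
  apply hu
  rw [← rotInv_rot hN hv hw u, h]
  simp [rotInv, planeRot]

/-- Makes the forward rotation to a normalized average match the backward rotation from the
unnormalized node, so that `rot_rotInv` cancels them. -/
theorem rot_unit_right (v w u : State N) : rot v (unit w) u = rot v w u := by
  rw [rot, rot, perpBase_unit_right, angle_unit_right]

end Vectors

/-! ### Weighted sums of direction trees. -/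

namespace DirectionTree

variable {N : ℕ} {ν : Type}

theorem eq_root_of_level_eq_zero (T : DirectionTree N ν) {n : ν} (h : T.level n = 0) :
    n = T.root := by
  by_contra hn
  have := T.level_parent n hn
  omega

theorem level_iterate_parent (T : DirectionTree N ν) (n : ν) :
    ∀ k ≤ T.level n, T.level (T.parent^[k] n) = T.level n - k
  | 0, _ => rfl
  | k + 1, hk => by
    have ih := T.level_iterate_parent n k (by omega)
    have hne : T.parent^[k] n ≠ T.root := by
      intro h
      rw [h, T.level_root] at ih
      omega
    have := T.level_parent _ hne
    rw [Function.iterate_succ_apply']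
    omega

theorem level_ancestorAt (T : DirectionTree N ν) (n : ν) {l : ℕ} (hl : l ≤ T.level n) :
    T.level (T.ancestorAt n l) = l := by
  rw [ancestorAt, T.level_iterate_parent n _ (Nat.sub_le _ _)]
  omega

theorem ancestorAt_ancestorAt (T : DirectionTree N ν) (n : ν) {a b : ℕ} (hab : a ≤ b)
    (hb : b ≤ T.level n) : T.ancestorAt (T.ancestorAt n b) a = T.ancestorAt n a := by
  rw [ancestorAt, T.level_ancestorAt n hb, ancestorAt, ← Function.iterate_add_apply, ancestorAt]
  congr 1
  omega

theorem ancestorAt_level (T : DirectionTree N ν) (n : ν) : T.ancestorAt n (T.level n) = n := by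
  simp [ancestorAt]

variable [Fintype ν]

/-- Each `dirMap v _` is orthogonal to `v`, whatever its second argument, so only the root direction
has to be nonzero. -/
theorem norm_reduce_fst (T : DirectionTree N ν) (hroot : T.value T.root ≠ 0) :
    ∀ l, ‖(T.reduce l).1‖ = 1
  | 0 => norm_unit hroot
  | l + 1 => by
    have ih := T.norm_reduce_fst hroot l
    refine norm_dirInv (norm_ne_zero_iff.1 (by rw [ih]; exact one_ne_zero)) ?_
    rw [inner_sum]
    refine Finset.sum_eq_zero fun c _ => ?_
    rw [real_inner_smul_right, inner_unit_dirMap, mul_zero]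

theorem norm_eval (T : DirectionTree N ν) (hroot : T.value T.root ≠ 0) : ‖T.eval‖ = 1 :=
  T.norm_reduce_fst hroot _

open Classical in
theorem cumWeight_of_single (T : DirectionTree N ν) {m : ν}
    (hw : ∀ n, T.weight n = if n = m then 1 else 0) (n : ν) :
    T.cumWeight n = if T.level n ≤ T.level m ∧ T.ancestorAt m (T.level n) = n then 1 else 0 := by
  simp only [cumWeight, hw]
  rw [Finset.sum_ite_eq']
  simp

open Classical in
/-- If the whole weight of a direction tree is at one node, then the weighted sum is the direction
of that node. -/
theorem eval_of_single (hN : 2 ≤ N) (T : DirectionTree N ν) {m : ν}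
    (hw : ∀ n, T.weight n = if n = m then 1 else 0)
    (hval : ∀ k, T.value (T.parent^[k] m) ≠ 0) : T.eval = unit (T.value m) := by
  -- Only ancestors of `m` have nonzero cumulative weight, and each level up to that of `m` has
  -- exactly one.
  have hsum : ∀ (l : ℕ) (g : ν → State N),
      ∑ c with T.level c = l, T.cumWeight c • g c
        = if l ≤ T.level m then g (T.ancestorAt m l) else 0 := by
    intro l g
    split_ifs with hl
    · rw [Finset.sum_eq_single (T.ancestorAt m l)]
      · rw [T.cumWeight_of_single hw, T.level_ancestorAt m hl, if_pos ⟨hl, rfl⟩, one_smul]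
      · intro c hc hne
        rw [T.cumWeight_of_single hw, (Finset.mem_filter.1 hc).2, if_neg (fun h => hne h.2.symm),
          zero_smul]
      · intro h
        exact absurd (by simp [T.level_ancestorAt m hl]) h
    · refine Finset.sum_eq_zero fun c hc => ?_
      rw [T.cumWeight_of_single hw, (Finset.mem_filter.1 hc).2, if_neg (fun h => hl h.1),
        zero_smul]
  have hanc : ∀ l, T.value (T.ancestorAt m l) ≠ 0 := fun l => hval _
  -- Invariant: the average walks down the path to `m` and stops there, while the directions on this
  -- path keep their initial values. The new average is the direction of the path node itself, so
  -- the two rotations of a step are inverse to each other.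
  have key : ∀ l, (T.reduce l).1 = unit (T.value (T.ancestorAt m (min l (T.level m)))) ∧
      ∀ a ≤ T.level m, (T.reduce l).2 (T.ancestorAt m a) = T.value (T.ancestorAt m a) := by
    intro l
    induction l with
    | zero =>
      refine ⟨?_, fun a _ => rfl⟩
      rw [Nat.zero_min, T.eq_root_of_level_eq_zero (T.level_ancestorAt m (Nat.zero_le _))]
      rfl
    | succ l ih =>
      obtain ⟨ih₁, ih₂⟩ := ih
      have hv : (T.reduce l).1 ≠ 0 := ih₁ ▸ unit_ne_zero (hval _)
      have hfst : (T.reduce (l + 1)).1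
          = unit (T.value (T.ancestorAt m (min (l + 1) (T.level m)))) := by
        change dirInv _ (∑ c with T.level c = l + 1, _) = _
        rw [hsum (l + 1) fun c => dirMap (T.reduce l).1 ((T.reduce l).2 c)]
        split_ifs with hl
        · rw [ih₂ _ hl, dirInv_dirMap hN hv (hanc _), min_eq_left hl]
        · rw [dirInv_zero, ih₁, unit_unit, min_eq_right (by omega), min_eq_right (by omega)]
      refine ⟨hfst, fun a ha => ?_⟩
      change (if l + 1 ≤ T.level (T.ancestorAt m a) then rot _ (T.reduce (l + 1)).1 _ else _) = _
      rw [T.level_ancestorAt m ha]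
      split_ifs with hl
      · rw [T.ancestorAt_ancestorAt m hl ha, ih₂ _ (hl.trans ha), ih₂ a ha, hfst,
          min_eq_left (hl.trans ha), rot_unit_right, rot_rotInv hN hv (hanc _)]
      · exact ih₂ a ha
  rw [eval, (key _).1, min_eq_right (Finset.le_sup (Finset.mem_univ m)), ancestorAt_level]

end DirectionTree

/-! ### Star-shaped obstacles, speed and pseudo-tangents. -/

namespace StarObstacle

variable {N : ℕ} (O : StarObstacle N)

theorem boundaryPoint_eq_self {x : State N} (hx : O.Γ x = 1) : O.boundaryPoint x = x := by
  have hne : x ≠ O.ref := by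
    rintro rfl
    exact O.ref_inside.ne hx
  have hd : 0 < ‖x - O.ref‖ := norm_pos_iff.2 (sub_ne_zero.2 hne)
  unfold boundaryPoint
  split_ifs with h
  · obtain ⟨hpos, hΓ⟩ := h.choose_spec
    have hb : h.choose * ‖x - O.ref‖⁻¹ = 1 := by
      refine (O.radial x hne).injOn (mul_nonneg hpos.le (inv_nonneg.2 hd.le))
        (show (0 : ℝ) ≤ 1 from zero_le_one) ?_
      simp only [one_smul, add_sub_cancel, hx]
      rw [← smul_smul]
      exact hΓ
    change O.ref + h.choose • (‖x - O.ref‖⁻¹ • (x - O.ref)) = x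
    rw [smul_smul, hb, one_smul, add_sub_cancel]
  · rfl

/-- Each half-line that starts in the interior of an obstacle meets its boundary. -/
theorem exists_boundary_of_interior {y d : State N} (hy : O.Γ y < 1) (hd : d ≠ 0) :
    ∃ t : ℝ, 0 < t ∧ O.Γ (y + t • d) = 1 := by
  obtain ⟨R, hR, hΓR⟩ : ∃ R : ℝ, 0 < R ∧ 1 < O.Γ (O.ref + R • d) := by
    have hne : O.ref + d ≠ O.ref := by simpa using hd
    obtain ⟨b, hb, hΓb⟩ := O.exists_boundary (O.ref + d) hne
    rw [add_sub_cancel_left, unit, smul_smul] at hΓb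
    have hpos : 0 < b * ‖d‖⁻¹ := mul_pos hb (inv_pos.2 (norm_pos_iff.2 hd))
    refine ⟨b * ‖d‖⁻¹ + 1, by positivity, ?_⟩
    have := O.radial (O.ref + d) hne (a := b * ‖d‖⁻¹) (b := b * ‖d‖⁻¹ + 1) hpos.le
      (show (0 : ℝ) ≤ _ by positivity) (by linarith)
    simp only [add_sub_cancel_left, hΓb] at this
    exact this
  -- Contracting `y + t • d` towards the reference point by `R / t` gives points that tend to `O.ref
  -- + R • d`, where `Γ > 1`. For `t ≥ R` the contraction does not increase `Γ`, so `y + t • d`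
  -- itself is eventually outside.
  have hlim : Filter.Tendsto (fun t : ℝ => O.Γ (O.ref + (R * t⁻¹) • (y + t • d - O.ref)))
      Filter.atTop (nhds (O.Γ (O.ref + R • d))) := by
    refine (O.continuous.tendsto _).comp (tendsto_const_nhds.add ?_)
    have h : Filter.Tendsto (fun t : ℝ => (R * t⁻¹) • (y - O.ref) + R • d) Filter.atTop
        (nhds ((R * 0) • (y - O.ref) + R • d)) :=
      ((tendsto_inv_atTop_zero.const_mul R).smul_const _).add tendsto_const_nhds
    rw [mul_zero, zero_smul, zero_add] at h
    refine h.congr' ?_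
    filter_upwards [Filter.eventually_gt_atTop 0] with t ht
    rw [show y + t • d - O.ref = (y - O.ref) + t • d by abel, smul_add (R * t⁻¹), smul_smul,
      mul_assoc, inv_mul_cancel₀ ht.ne', mul_one]
  obtain ⟨t, h₁, htR, ht⟩ := ((hlim.eventually (lt_mem_nhds hΓR)).and
    ((Filter.eventually_ge_atTop R).and (Filter.eventually_gt_atTop 0))).exists
  have hout : 1 < O.Γ (y + t • d) := by
    by_cases hne : y + t • d = O.ref
    · rw [hne, sub_self, smul_zero, add_zero] at h₁
      exact absurd h₁ O.ref_inside.not_gt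
    · have := (O.radial _ hne).monotoneOn (a := R * t⁻¹) (b := 1) (show (0 : ℝ) ≤ _ by positivity)
        (show (0 : ℝ) ≤ 1 from zero_le_one)
        (by rw [← div_eq_mul_inv]; exact (div_le_one ht).2 htR)
      simp only [one_smul, add_sub_cancel] at this
      exact h₁.trans_le this
  have hcont : ContinuousOn (fun t : ℝ => O.Γ (y + t • d)) (Set.Icc 0 t) :=
    (O.continuous.comp (by fun_prop)).continuousOn
  obtain ⟨c, hc, hΓc⟩ := intermediate_value_Ioo ht.le hcont
    (show (1 : ℝ) ∈ Set.Ioo _ _ from ⟨by simpa using hy, hout⟩)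
  exact ⟨c, hc.1, hΓc⟩

theorem speed_pos {Re : ℝ} {x c : State N} (hx : 1 < O.Γ x) : 0 < O.speed Re x c := by
  have : 0 < 1 - 1 / O.Γ x := by
    rw [sub_pos, div_lt_one (by linarith)]
    exact hx
  exact lt_min one_pos (by positivity)

theorem speed_nonneg {Re : ℝ} {x c : State N} : 0 ≤ O.speed Re x c :=
  le_min zero_le_one (by positivity)

/-- Covers the boundary points where the velocity has the reference direction in direction space,
and the pseudo-tangent need not avoid the obstacle. -/
theorem speed_eq_zero {Re : ℝ} {x c : State N} (hx : O.Γ x = 1) (hc : O.deltaK x c = 0) :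
    O.speed Re x c = 0 := by simp [speed, hx, hc]

theorem norm_intersectCircle {b p q : State N} {R : ℝ} (hb : b ≠ 0) (hq : q ≠ 0) :
    ‖intersectCircle b p q R‖ = 1 := by
  unfold intersectCircle
  split_ifs with h
  · refine norm_dirInv hb ?_
    simp [inner_add_right, inner_sub_right, real_inner_smul_right, inner_unit_dirMap]
  · exact norm_unit hq

theorem inner_intersectCircle {b p q : State N} {R : ℝ} (hb : b ≠ 0)
    (h : ∃ a : ℝ, 0 < a ∧ ‖dirMap b p + a • (dirMap b q - dirMap b p)‖ = R) :
    ⟪unit b, intersectCircle b p q R⟫ = Real.cos R := by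
  rw [intersectCircle, dif_pos h, inner_unit_dirInv hb, h.choose_spec.2]
  simp [inner_add_right, inner_sub_right, real_inner_smul_right, inner_unit_dirMap]

/-- A half-line through a point `q` of the ball leaves the ball at or beyond `q`, by the
intermediate value theorem. The point `p` itself may lie outside. -/
theorem exists_norm_add_smul_sub_eq {p q : State N} {R : ℝ} (hpq : p ≠ q) (hq : ‖q‖ ≤ R) :
    ∃ a : ℝ, 0 < a ∧ ‖p + a • (q - p)‖ = R := by
  have hd : 0 < ‖q - p‖ := norm_pos_iff.2 (sub_ne_zero.2 hpq.symm)
  -- Chosen so that the displacement has length at least `R + ‖p‖`; the triangle inequality then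
  -- puts the endpoint outside the open ball.
  set a₁ : ℝ := 1 + (R + ‖p‖) / ‖q - p‖ with ha₁
  have hR : 0 ≤ R := (norm_nonneg _).trans hq
  have h1 : 1 ≤ a₁ := le_add_of_nonneg_right (by positivity)
  have hlarge : R ≤ ‖p + a₁ • (q - p)‖ := by
    have h2 : ‖a₁ • (q - p)‖ = ‖q - p‖ + (R + ‖p‖) := by
      rw [norm_smul, Real.norm_eq_abs, abs_of_nonneg (by linarith), ha₁]
      field_simp
    have h3 := norm_sub_le (p + a₁ • (q - p)) p
    rw [add_sub_cancel_left, h2] at h3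
    linarith
  have hcont : ContinuousOn (fun a : ℝ => ‖p + a • (q - p)‖) (Set.Icc 1 a₁) := by fun_prop
  obtain ⟨a, ha, h⟩ := intermediate_value_Icc h1 hcont
    (show R ∈ Set.Icc _ _ from ⟨by simpa using hq, hlarge⟩)
  exact ⟨a, zero_lt_one.trans_le ha.1, h⟩

theorem norm_pseudoTangent {Re : ℝ} {x v : State N} (hn : O.normal x ≠ 0) (hv : v ≠ 0) :
    ‖O.pseudoTangent Re x v‖ = 1 := by
  unfold pseudoTangent
  split_ifs
  · exact norm_intersectCircle (neg_ne_zero.2 hn) hv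
  · exact norm_intersectCircle hn hv

/-- The pseudo-tangent does not point into the obstacle. -/
theorem inner_normal_pseudoTangent {Re : ℝ} (hRe : Re ∈ Set.Icc (Real.pi / 2) Real.pi)
    {x v : State N} (hv : v ≠ 0) (hΔ : O.deltaK x v ≠ 0) :
    0 ≤ ⟪O.normal x, O.pseudoTangent Re x v⟫ := by
  by_cases hn : O.normal x = 0
  · simp [hn]
  have hcos : Real.cos Re ≤ 0 :=
    Real.cos_nonpos_of_pi_div_two_le_of_le hRe.1 (by linarith [hRe.2, Real.pi_pos])
  rw [← norm_smul_unit (O.normal x), real_inner_smul_left]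
  refine mul_nonneg (norm_nonneg _) ?_
  unfold pseudoTangent
  split_ifs with h
  -- The branch condition places the velocity inside the ball of radius `Re` in direction space.
  -- With `Δk ≠ 0` the intersection thus exists, and its inner product with the inward unit normal
  -- is `cos Re ≤ 0`.
  · have hang : angle (-O.normal x) v < Re := by
      by_contra! hle
      rw [← unit_neg, inner_unit_unit _ _ (neg_ne_zero.2 hn) hv] at h
      have := Real.cos_le_cos_of_nonneg_of_le_pi (by linarith [hRe.1, Real.pi_pos])
        (angle_le_pi _ _) hle
      linarith
    have := inner_intersectCircle (neg_ne_zero.2 hn)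
      (exists_norm_add_smul_sub_eq (R := Re)
        (p := dirMap (-O.normal x) (O.refDir x)) (q := dirMap (-O.normal x) v)
        (fun h => hΔ (by rw [deltaK, h, sub_self, norm_zero]))
        ((norm_dirMap_le _ _).trans hang.le))
    rw [unit_neg, inner_neg_left] at this
    linarith
  -- Existence is not needed here: an intersection has outward component `cos (π - Re) ≥ 0`, and the
  -- fallback direction, that of `v`, satisfies the bound by the branch condition.
  · by_cases hex : ∃ a : ℝ, 0 < a ∧ ‖dirMap (O.normal x) (-O.refDir x) +
        a • (dirMap (O.normal x) v - dirMap (O.normal x) (-O.refDir x))‖ = Real.pi - Re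
    · rw [inner_intersectCircle hn hex, Real.cos_pi_sub]
      linarith
    · rw [intersectCircle, dif_neg hex]
      rw [inner_neg_left] at h
      linarith

end StarObstacle

/-! ### Nonvanishing of the propagated surface vectors and velocities. -/

namespace ObstacleTree

variable {N : ℕ} {ι : Type}

theorem level_iterate_parent (T : ObstacleTree N ι) (o : ι) :
    ∀ k ≤ T.level o, T.level (T.parent^[k] o) = T.level o - k
  | 0, _ => rfl
  | k + 1, hk => by
    have ih := T.level_iterate_parent o k (by omega)
    have hne : T.parent^[k] o ≠ T.root := by
      intro h
      rw [h, T.level_root] at ih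
      omega
    have := T.level_parent _ hne
    rw [Function.iterate_succ_apply']
    omega

/-- The fallback value `s` never occurs: the half-line from `s` passes through `c.ref`, inside `p`,
and must leave `p` afterwards. The result is thus on the boundary of `p`, unlike `p.ref`. -/
theorem propagate_ne_ref {c p : StarObstacle N} {s : State N} (hs : s ≠ c.ref)
    (hc : p.Γ c.ref < 1) : propagate c p s ≠ p.ref := by
  have hne : ∀ y, p.Γ y = 1 → y ≠ p.ref := by
    rintro y hy rfl
    exact p.ref_inside.ne hy
  unfold propagate
  split_ifs with h₁ h₂
  · exact hne _ h₁.choose_spec.2.1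
  · exact hne _ h₂.choose_spec.2
  · refine absurd ?_ h₂
    obtain ⟨t, ht, hΓ⟩ := p.exists_boundary_of_interior hc (sub_ne_zero.2 hs.symm)
    -- The exit parameter `t` is measured from `c.ref`, which has parameter `1` on the half-line
    -- from `s`.
    refine ⟨1 + t, by positivity, ?_⟩
    rw [show (1 + t) • (c.ref - s) + s = c.ref + t • (c.ref - s) by module, hΓ]

theorem surfaceDir_ne_zero (T : ObstacleTree N ι) (hchild : ∀ o, o ≠ T.root →
      (T.obs o).ref ∈ (T.obs o).interior ∩ (T.obs (T.parent o)).interior)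
    {x : State N} {o : ι} (hx : (T.obs o).Γ x = 1) :
    ∀ k ≤ T.level o, T.surfaceDir x o k ≠ 0
  | 0, _ => by
    refine sub_ne_zero.2 ?_
    change (T.obs o).boundaryPoint x ≠ (T.obs o).ref
    rw [(T.obs o).boundaryPoint_eq_self hx]
    rintro rfl
    exact (T.obs o).ref_inside.ne hx
  | k + 1, hk => by
    have ih := T.surfaceDir_ne_zero hchild hx k (by omega)
    have hne : T.parent^[k] o ≠ T.root := by
      intro h
      have := T.level_iterate_parent o k (by omega)
      rw [h, T.level_root] at this
      omega
    refine sub_ne_zero.2 (propagate_ne_ref (sub_ne_zero.1 ih) ?_)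
    rw [Function.iterate_succ_apply']
    exact (hchild _ hne).2

theorem velocityAt_ne_zero (T : ObstacleTree N ι) (hN : 2 ≤ N) (hchild : ∀ o, o ≠ T.root →
      (T.obs o).ref ∈ (T.obs o).interior ∩ (T.obs (T.parent o)).interior)
    {f : State N → State N} (hf₀ : f (T.obs T.root).ref ≠ 0)
    {x : State N} {o : ι} (hx : (T.obs o).Γ x = 1) : ∀ j, T.velocityAt f x o j ≠ 0
  | 0 => unit_ne_zero hf₀
  | j + 1 => rot_ne_zero hN (T.surfaceDir_ne_zero hchild hx _ (Nat.sub_le _ _))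
      (T.surfaceDir_ne_zero hchild hx _ (Nat.sub_le _ _))
      (T.velocityAt_ne_zero hN hchild hf₀ hx j)

/-! ### Weights and the field, on the boundary of one obstacle and in free space. -/

variable (T : ObstacleTree N ι)

/-- The surface point of `o` is `x` itself, which lies outside the parent; the levels ensure that
the parent is a different obstacle. -/
theorem hidingWeight_of_mem_boundaryOf {x : State N} {o : ι} (hx : x ∈ T.boundaryOf o) :
    T.hidingWeight x o = 1 := by
  unfold hidingWeight
  split_ifs with h
  · rfl
  · have hp : T.parent o ≠ o := by
      intro hp
      have := T.level_parent o h
      rw [hp] at this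
      omega
    rw [(T.obs o).boundaryPoint_eq_self hx.1]
    exact if_pos (hx.2 _ hp)

variable [Fintype ι]

open Classical in
-- Every product except that of `o` contains the zero factor `Γ_o - 1`.
theorem obstacleWeight_of_mem_boundaryOf {x : State N} {o : ι} (hx : x ∈ T.boundaryOf o) (i : ι) :
    T.obstacleWeight x i = if i = o then 1 else 0 := by
  have h0 : ∀ j, j ≠ o → ∏ i ∈ Finset.univ.erase j, ((T.obs i).Γ x - 1) = 0 := fun j hj =>
    Finset.prod_eq_zero (Finset.mem_erase.2 ⟨hj.symm, Finset.mem_univ o⟩)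
      (sub_eq_zero.2 hx.1)
  have hpos : ∏ i ∈ Finset.univ.erase o, ((T.obs i).Γ x - 1) ≠ 0 :=
    Finset.prod_ne_zero_iff.2 fun i hi =>
      (sub_pos.2 (hx.2 i (Finset.ne_of_mem_erase hi))).ne'
  rw [obstacleWeight, Finset.sum_eq_single o (fun j _ hj => h0 j hj)
    (fun h => absurd (Finset.mem_univ o) h)]
  split_ifs with hi
  · rw [hi, div_self hpos]
  · rw [h0 i hi, zero_div]

theorem obstacleWeight_pos {x : State N} (hx : x ∈ T.free) (o : ι) :
    0 < T.obstacleWeight x o := by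
  classical
  have h : ∀ j, 0 < ∏ i ∈ Finset.univ.erase j, ((T.obs i).Γ x - 1) := fun j =>
    Finset.prod_pos fun i _ => sub_pos.2 (hx i)
  exact div_pos (h o) (Finset.sum_pos (fun j _ => h j) ⟨o, Finset.mem_univ o⟩)

open Classical in
theorem nodeWeight_of_mem_boundaryOf {Re s : ℝ} {f : State N → State N} {x : State N} {o : ι}
    (hx : x ∈ T.boundaryOf o) (hΔ : (T.obs o).deltaK x (T.velocity f x o) ≠ 0) (i : ι) :
    T.nodeWeight Re s f x i = if i = o then 1 else 0 := by
  rw [nodeWeight, T.obstacleWeight_of_mem_boundaryOf hx]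
  split_ifs with hi
  · subst hi
    have hΓ : (T.obs i).Γ x = 1 := hx.1
    rw [T.hidingWeight_of_mem_boundaryOf hx, StarObstacle.rotWeight, if_neg hΔ, hΓ, div_one,
      Real.one_rpow]
    norm_num
  · simp

open Classical in
/-- On the boundary of a single obstacle the weighted sum of the rotation tree is the
pseudo-tangent of this obstacle. -/
theorem eval_rotationTree_of_mem_boundaryOf (hN : 2 ≤ N) (hchild : ∀ o, o ≠ T.root →
      (T.obs o).ref ∈ (T.obs o).interior ∩ (T.obs (T.parent o)).interior)
    {f : State N → State N} (hf₀ : f (T.obs T.root).ref ≠ 0) {Re s : ℝ} {x : State N} {o : ι}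
    (hx : x ∈ T.boundaryOf o) (hΔ : (T.obs o).deltaK x (T.velocity f x o) ≠ 0)
    (hfx : f x ≠ 0) (hn : (T.obs o).normal x ≠ 0) :
    (T.rotationTree Re s f x).eval = (T.obs o).pseudoTangent Re x (T.velocity f x o) := by
  have hvel := T.velocityAt_ne_zero hN hchild hf₀ hx.1
  have htan : ‖(T.obs o).pseudoTangent Re x (T.velocity f x o)‖ = 1 :=
    (T.obs o).norm_pseudoTangent hn (hvel (T.level o))
  have hvalue : ∀ j : Fin (T.level o + 2), (T.rotationTree Re s f x).value (some ⟨o, j⟩) ≠ 0 := by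
    intro j
    change (if (j : ℕ) ≤ T.level o then _ else _) ≠ (0 : State N)
    split_ifs
    · exact hvel _
    · exact norm_ne_zero_iff.1 (htan.trans_ne one_ne_zero)
  -- Ancestors of the pseudo-tangent stay in the branch of `o` or are the root, so nonzero
  -- directions are needed only there.
  have hpath : ∀ k,
      (T.rotationTree Re s f x).parent^[k] (some ⟨o, Fin.last (T.level o + 1)⟩) = none ∨
      ∃ j, (T.rotationTree Re s f x).parent^[k] (some ⟨o, Fin.last (T.level o + 1)⟩)
        = some ⟨o, j⟩ := by
    intro k
    induction k with
    | zero => exact .inr ⟨_, rfl⟩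
    | succ k ih =>
      rw [Function.iterate_succ_apply']
      rcases ih with ih | ⟨j, ih⟩
      · exact .inl (by rw [ih]; rfl)
      · rw [ih]
        by_cases hj : (j : ℕ) = 0
        · exact .inl (if_pos hj)
        · exact .inr ⟨_, if_neg hj⟩
  rw [DirectionTree.eval_of_single hN (m := some ⟨o, Fin.last (T.level o + 1)⟩)]
  · change unit (if T.level o + 1 ≤ T.level o then _ else _) = _
    rw [if_neg (by omega), unit_of_norm_eq_one htan]
  · rintro (_ | ⟨i, j⟩)
    · change 1 - ∑ o, T.nodeWeight Re s f x o = _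
      rw [Finset.sum_congr rfl fun i _ => T.nodeWeight_of_mem_boundaryOf hx hΔ i]
      simp
    · change (if (j : ℕ) ≤ T.level i then 0 else T.nodeWeight Re s f x i) = _
      rw [T.nodeWeight_of_mem_boundaryOf hx hΔ]
      by_cases hi : i = o
      · subst hi
        rw [if_pos rfl]
        by_cases hj : (j : ℕ) ≤ T.level i
        · rw [if_pos hj, if_neg]
          simp only [Option.some.injEq, Sigma.mk.injEq, heq_eq_eq, true_and]
          rintro rfl
          simp at hj
        · rw [if_neg hj, if_pos]
          simp only [Option.some.injEq, Sigma.mk.injEq, heq_eq_eq, true_and]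
          ext
          simp only [Fin.val_last]
          omega
      · rw [if_neg hi, ite_self, if_neg]
        intro h
        exact hi (by simpa using congrArg (Option.map Sigma.fst) h)
  · intro k
    rcases hpath k with h | ⟨j, h⟩
    · rw [h]
      exact hfx
    · rw [h]
      exact hvalue j

theorem inner_normal_field_nonneg (hN : 2 ≤ N) (hchild : ∀ o, o ≠ T.root →
      (T.obs o).ref ∈ (T.obs o).interior ∩ (T.obs (T.parent o)).interior)
    {f : State N → State N} (hf₀ : f (T.obs T.root).ref ≠ 0) {Re s : ℝ}
    (hRe : Re ∈ Set.Icc (Real.pi / 2) Real.pi) {x : State N} {o : ι} (hx : x ∈ T.boundaryOf o) :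
    0 ≤ ⟪(T.obs o).normal x, T.field Re s f x⟫ := by
  classical
  by_cases hfx : f x = 0
  · simp [field, hfx]
  by_cases hn : (T.obs o).normal x = 0
  · simp [hn]
  have hspeed : ∑ i, T.obstacleWeight x i * (T.obs i).speed Re x (T.velocity f x i)
      = (T.obs o).speed Re x (T.velocity f x o) := by
    rw [Finset.sum_congr rfl fun i _ => by rw [T.obstacleWeight_of_mem_boundaryOf hx i]]
    simp
  rw [field, hspeed, real_inner_smul_right]
  -- If `Δk = 0`, the pseudo-tangent has no weight and the sum is not controlled, but the speed is
  -- zero.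
  by_cases hΔ : (T.obs o).deltaK x (T.velocity f x o) = 0
  · rw [(T.obs o).speed_eq_zero hx.1 hΔ]
    simp
  · rw [T.eval_rotationTree_of_mem_boundaryOf hN hchild hf₀ hx hΔ hfx hn]
    exact mul_nonneg (mul_nonneg (T.obs o).speed_nonneg (norm_nonneg _))
      ((T.obs o).inner_normal_pseudoTangent hRe
        (T.velocityAt_ne_zero hN hchild hf₀ hx.1 _) hΔ)

theorem field_eq_zero_iff {f : State N → State N} {Re s : ℝ} {x : State N} (hx : x ∈ T.free) :
    T.field Re s f x = 0 ↔ f x = 0 := by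
  refine ⟨fun h => ?_, fun h => by simp [field, h]⟩
  by_contra hfx
  have heval : ‖(T.rotationTree Re s f x).eval‖ = 1 := DirectionTree.norm_eval _ hfx
  have hspeed : 0 < ∑ o, T.obstacleWeight x o * (T.obs o).speed Re x (T.velocity f x o) :=
    Finset.sum_pos (fun o _ => mul_pos (T.obstacleWeight_pos hx o) ((T.obs o).speed_pos (hx o)))
      ⟨T.root, Finset.mem_univ _⟩
  have hnorm := congrArg norm h
  rw [field, norm_smul, heval, norm_zero, mul_one, norm_eq_zero] at hnorm
  exact (mul_pos hspeed (norm_pos_iff.2 hfx)).ne' hnorm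

end ObstacleTree

end Roam

open Roam in
theorem mainTheorem2 {N : ℕ} (hN : 2 ≤ N) {ι : Type} [Fintype ι] (T : ObstacleTree N ι)
    (f : State N → State N) (Re s : ℝ)
    (hRe : Re ∈ Set.Icc (Real.pi / 2) Real.pi) (hs : 0 < s)
    -- the reference point of each obstacle lies in the obstacle and in its parent
    (hchild : ∀ o, o ≠ T.root →
      (T.obs o).ref ∈ (T.obs o).interior ∩ (T.obs (T.parent o)).interior)
    -- the reference point of the parent lies in the parent, outside of the obstacle
    (hparent : ∀ o, o ≠ T.root →
      (T.obs (T.parent o)).ref ∈ (T.obs (T.parent o)).interior \ (T.obs o).interior)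
    -- the direction to the parent does not oppose the one from the parent to the grandparent
    (hopp : ∀ c, c ≠ T.root → T.parent c ≠ T.root →
      inner ℝ (unit ((T.obs (T.parent c)).ref - (T.obs c).ref))
        (unit ((T.obs (T.parent (T.parent c))).ref - (T.obs (T.parent c)).ref)) ≠ -1)
    (hf : ContDiff ℝ 1 f)
    -- the dynamics are straight in the surrounding of the tree
    (hstraight : ∃ U : Set (State N), IsOpen U ∧ (∀ o, {x | (T.obs o).Γ x ≤ 1} ⊆ U) ∧
      StraightOn f U)
    (hf₀ : f (T.obs T.root).ref ≠ 0) :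
    (∀ o, ∀ x ∈ T.boundaryOf o, 0 ≤ inner ℝ ((T.obs o).normal x) (T.field Re s f x)) ∧
    (∀ x ∈ T.free, T.field Re s f x = 0 ↔ f x = 0) := by
  exact ⟨fun o x hx => T.inner_normal_field_nonneg hN hchild hf₀ hRe hx,
    fun x hx => T.field_eq_zero_iff hx⟩
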